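/- Let $\nu$ be a measure on $(0,\infty)$ with $\int_{(0,\infty)}\min\{1,x\}\,\nu(dx)<\infty$ and $\nu((0,\infty))=\infty$, and put $f(u)=\int_{(0,\infty)}(1-e^{-ux})\,\nu(dx)$ for $u\ge 0$. On a probability space $(\Omega,\mathcal F,\mathbb P)$ let $T^f=(T^f(t))_{t\ge 0}$ be a subordinator with Laplace exponent $f$, i.e. a process with $T^f(0)=0$ a.s., with stationary and independent increments and a.s. increasing, right-continuous paths with finite left limits, such that $\mathbb E\, e^{-uT^f(t)}=e^{-tf(u)}$ for all $t,u\ge 0$. Let $S^f(t)=\inf\{\tau>0 : T^f(\tau)>t\}$, $t\ge 0$, be the inverse subordinator, let $B$ be a standard one-dimensional Brownian motion such that $B$ and $S^f$ are independent, and let $X(t)=B(S^f(t))$, $t\ge 0$. Then \[ \lim_{t\to\infty}\frac{X(t)}{t}=0\qquad\text{almost surely.} \] -/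

import Mathlib

open MeasureTheory ProbabilityTheory Filter Topology
open scoped NNReal ENNReal

noncomputable section

namespace DelayedBM

variable {Ω : Type*} {mΩ : MeasurableSpace Ω}

/-- A path `x : [0,∞) → ℝ` that is right-continuous and has finite left limits. (At `t = 0` the
left-limit condition is void.) -/
structure IsCadlagPath (x : ℝ≥0 → ℝ) : Prop where
  right_cont : ∀ t, ContinuousWithinAt x (Set.Ici t) t
  left_lim : ∀ t, ∃ l : ℝ, Tendsto x (𝓝[<] t) (𝓝 l)

/-- A real-valued Lévy process: it starts at `0`, has independent and stationary increments, and
almost all of its paths are right-continuous with finite left limits. -/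
structure IsLevyProcess (T : ℝ≥0 → Ω → ℝ) (P : Measure Ω) : Prop where
  aemeasurable : ∀ t, AEMeasurable (T t) P
  zero : ∀ᵐ ω ∂P, T 0 ω = 0
  indep_increments : HasIndepIncrements T P
  stationary_increments : ∀ s t, IdentDistrib (fun ω ↦ T (s + t) ω - T s ω) (T t) P P
  cadlag : ∀ᵐ ω ∂P, IsCadlagPath (fun t ↦ T t ω)

/-- A subordinator: a Lévy process with almost surely increasing (non-decreasing) paths. -/
structure IsSubordinator (T : ℝ≥0 → Ω → ℝ) (P : Measure Ω) : Prop
    extends IsLevyProcess T P where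
  mono : ∀ᵐ ω ∂P, Monotone (fun t ↦ T t ω)

/-- A Lévy measure of a subordinator: a measure supported in `(0,∞)` with
`∫_{(0,∞)} min {1, x} ν(dx) < ∞`. -/
structure IsSubordinatorLevyMeasure (ν : Measure ℝ) : Prop where
  support : ν (Set.Iic 0) = 0
  lintegral_lt_top : ∫⁻ x in Set.Ioi (0 : ℝ), ENNReal.ofReal (min 1 x) ∂ν < ∞

/-- The Bernstein function `f(u) = ∫_{(0,∞)} (1 - e^{-ux}) ν(dx)` without drift and with Lévy
measure `ν`. For `u ≥ 0` the integrand is `ν`-integrable whenever `ν` is a Lévy measure. -/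
def bernstein (ν : Measure ℝ) (u : ℝ) : ℝ :=
  ∫ x in Set.Ioi (0 : ℝ), (1 - Real.exp (-(u * x))) ∂ν

/-- `f` is the Laplace exponent of `T`: `E e^{-u T(t)} = e^{-t f(u)}` for all `t, u ≥ 0`. -/
def HasLaplaceExponent (T : ℝ≥0 → Ω → ℝ) (f : ℝ → ℝ) (P : Measure Ω) : Prop :=
  ∀ (t : ℝ≥0) (u : ℝ), 0 ≤ u → ∫ ω, Real.exp (-(u * T t ω)) ∂P = Real.exp (-(t * f u))

/-- The inverse subordinator (first-passage time process)
`S(t) = inf {τ > 0 : T(τ) > t}`. For a subordinator with a non-zero Lévy measure almost all paths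
are unbounded, so that almost surely the infimum is over a non-empty set for every `t`. -/
def inverseSubordinator (T : ℝ≥0 → Ω → ℝ) (t : ℝ≥0) (ω : Ω) : ℝ≥0 :=
  sInf {τ : ℝ≥0 | 0 < τ ∧ (t : ℝ) < T τ ω}

/-- The subdiffusion process `X(t) = B(S(t))`, where `S` is the inverse of `T`. -/
def subdiffusion (B T : ℝ≥0 → Ω → ℝ) (t : ℝ≥0) (ω : Ω) : ℝ :=
  B (inverseSubordinator T t ω) ω

end DelayedBM

end

open MeasureTheory ProbabilityTheory Filter Topology
open scoped NNReal ENNReal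

namespace DelayedBM

variable {Ω : Type*} {mΩ : MeasurableSpace Ω} {P : Measure Ω}

/-! The argument is pathwise: `B s / s → 0`, while `S` grows at most linearly, so `B (S t) / t → 0`.
Time inversion turns the first fact into continuity of Brownian motion at `0`. For the second,
Chernoff's bound at `u = 1` gives `P (T n ≤ f 1 / 2 * n) ≤ exp (-(f 1 / 2)) ^ n`; by Borel–Cantelli
`T n > f 1 / 2 * n` eventually, hence `S t ≤ 2 t / f 1 + K`. -/

/-- Two pre-Brownian motions have the same law along any sequence of times. -/
theorem identDistrib_of_isPreBrownianReal {B W : ℝ≥0 → Ω → ℝ} [IsFiniteMeasure P]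
    (hB : IsPreBrownianReal B P) (hW : IsPreBrownianReal W P) (d : ℕ → ℝ≥0) :
    IdentDistrib (fun ω n ↦ B (d n) ω) (fun ω n ↦ W (d n) ω) P P := by
  have key (I : Finset ℕ) : IdentDistrib (fun ω ↦ I.restrict fun n ↦ B (d n) ω)
      (fun ω ↦ I.restrict fun n ↦ W (d n) ω) P P := by
    have h : IdentDistrib (fun ω ↦ (I.image d).restrict (B · ω))
        (fun ω ↦ (I.image d).restrict (W · ω)) P P :=
      ⟨(hB.hasLaw _).aemeasurable, (hW.hasLaw _).aemeasurable,
        by rw [(hB.hasLaw _).map_eq, (hW.hasLaw _).map_eq]⟩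
    let u : (I.image d → ℝ) → (I → ℝ) :=
      fun x n ↦ x ⟨d n, Finset.mem_image_of_mem d n.2⟩
    have hu : Measurable u := measurable_pi_lambda _ fun n ↦ measurable_pi_apply _
    exact h.comp hu
  exact (identDistrib_iff_forall_finset_identDistrib
    (X := fun n ω ↦ B (d n) ω) (Y := fun n ω ↦ W (d n) ω)
    (aemeasurable_pi_lambda _ fun n ↦ hB.aemeasurable _)
    (aemeasurable_pi_lambda _ fun n ↦ hW.aemeasurable _)).2 key

/-- Sequences that, when read as values of a function along `d`, tend to `0` at `0`. -/
def vanishingAtZero (d : ℕ → ℝ≥0) : Set (ℕ → ℝ) :=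
  {x | ∀ k : ℕ, ∃ m : ℕ, ∀ n, d n < 1 / ((m : ℝ≥0) + 1) → |x n| ≤ 1 / ((k : ℝ) + 1)}

/-- Taking ε and δ of the form `1 / (k + 1)` keeps all operations countable. -/
theorem measurableSet_vanishingAtZero (d : ℕ → ℝ≥0) : MeasurableSet (vanishingAtZero d) := by
  have : vanishingAtZero d = ⋂ k : ℕ, ⋃ m : ℕ, ⋂ n : ℕ, ⋂ _ : d n < 1 / ((m : ℝ≥0) + 1),
      {x : ℕ → ℝ | |x n| ≤ 1 / ((k : ℝ) + 1)} := by
    ext x; simp [vanishingAtZero]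
  rw [this]
  refine .iInter fun k ↦ .iUnion fun m ↦ .iInter fun n ↦ .iInter fun _ ↦ ?_
  exact measurableSet_le (measurable_pi_apply n).abs measurable_const

/-- The law of large numbers for Brownian motion. -/
theorem tendsto_brownian_div_atTop {B : ℝ≥0 → Ω → ℝ} [IsFiniteMeasure P]
    (hB : IsBrownianReal B P) :
    ∀ᵐ ω ∂P, Tendsto (fun s : ℝ≥0 ↦ B s ω / (s : ℝ)) atTop (𝓝 0) := by
  have hd : DenseRange (TopologicalSpace.denseSeq ℝ≥0) := TopologicalSpace.denseRange_denseSeq _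
  set d := TopologicalSpace.denseSeq ℝ≥0
  -- Along `d`, `B` has the same law as its time inversion `t * B (1 / t)`, which therefore inherits
  -- the vanishing at `0`.
  have hid := identDistrib_of_isPreBrownianReal hB.toIsPreBrownianReal
    hB.toIsPreBrownianReal.inv d
  have h0 : ∀ᵐ ω ∂P, (fun n ↦ B (d n) ω) ∈ vanishingAtZero d := by
    filter_upwards [hB.tendsto_nhds_zero] with ω hω k
    have h1 : ∀ᶠ s in 𝓝 (0 : ℝ≥0), |B s ω| < 1 / ((k : ℝ) + 1) := by
      have := hω.abs
      rw [abs_zero] at this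
      exact this.eventually_lt_const Nat.one_div_pos_of_nat
    have h2 : Tendsto (fun m : ℕ ↦ 1 / ((m : ℝ≥0) + 1)) atTop (𝓝 0) :=
      tendsto_one_div_add_atTop_nhds_zero_nat
    obtain ⟨δ, hδ, hs⟩ := (nhds_bot_basis (α := ℝ≥0)).eventually_iff.1 h1
    obtain ⟨m, hm⟩ := (h2.eventually_lt_const hδ).exists
    exact ⟨m, fun n hn ↦ (hs (hn.trans hm)).le⟩
  have h1 := hid.ae_mem_snd (measurableSet_vanishingAtZero d) h0
  filter_upwards [h1, hB.cont] with ω hω hc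
  rw [Metric.tendsto_atTop]
  intro ε hε
  obtain ⟨k, hk⟩ := exists_nat_one_div_lt hε
  obtain ⟨m, hm⟩ := hω k
  refine ⟨(m : ℝ≥0) + 2, fun s hs ↦ ?_⟩
  have hs0 : 0 < s := lt_of_lt_of_le (by positivity) hs
  -- Path continuity at `t > 0` carries the bound from the dense times `d n` to all times.
  have hbd : ∀ t ∈ Set.Ioo (0 : ℝ≥0) (1 / ((m : ℝ≥0) + 1)),
      |(t : ℝ) * B (1 / t) ω| ≤ 1 / ((k : ℝ) + 1) := by
    intro t ht
    have hcont : ContinuousAt (fun t : ℝ≥0 ↦ |(t : ℝ) * B (1 / t) ω|) t := by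
      have hinv : ContinuousAt (fun t : ℝ≥0 ↦ 1 / t) t := by
        simpa only [one_div] using continuousAt_inv₀ ht.1.ne'
      exact (NNReal.continuous_coe.continuousAt.mul
        (ContinuousAt.comp (g := (B · ω)) hc.continuousAt hinv)).abs
    by_contra! hlt
    have hev : ∀ᶠ r : ℝ≥0 in 𝓝 t, 1 / ((k : ℝ) + 1) < |(r : ℝ) * B (1 / r) ω| :=
      hcont.eventually (lt_mem_nhds hlt)
    obtain ⟨n, hn1, hn2⟩ := hd.exists_mem_open isOpen_interior
      ⟨t, mem_interior_iff_mem_nhds.2 (hev.and (gt_mem_nhds ht.2))⟩ |>.imp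
        fun n hn ↦ interior_subset hn
    exact absurd (hm n hn2) (not_le.2 hn1)
  have h2 := hbd (1 / s) ⟨by positivity, by
    apply one_div_lt_one_div_of_lt (by positivity)
    exact lt_of_lt_of_le (by gcongr; norm_num) hs⟩
  rw [one_div_one_div] at h2
  rw [dist_zero_right, Real.norm_eq_abs]
  refine lt_of_le_of_lt (le_of_eq ?_) (h2.trans_lt hk)
  rw [div_eq_inv_mul]; simp

/-- Integrability, from `1 - e^{-x} ≤ min 1 x`, excludes the default value `0` of the integral; the
integrand is positive on all of `(0, ∞)`. -/
theorem bernstein_one_pos {ν : Measure ℝ} (hν : IsSubordinatorLevyMeasure ν)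
    (hν0 : ν (Set.Ioi 0) ≠ 0) : 0 < bernstein ν 1 := by
  have hint : IntegrableOn (fun x : ℝ ↦ 1 - Real.exp (-(1 * x))) (Set.Ioi 0) ν := by
    have hmin : IntegrableOn (fun x : ℝ ↦ min 1 x) (Set.Ioi 0) ν := by
      refine ⟨by fun_prop, ?_⟩
      rw [hasFiniteIntegral_iff_ofReal]
      · exact hν.lintegral_lt_top
      · filter_upwards [ae_restrict_mem measurableSet_Ioi] with x hx
        exact le_min zero_le_one (le_of_lt hx)
    refine hmin.mono' (by fun_prop) ?_
    filter_upwards [ae_restrict_mem measurableSet_Ioi] with x hx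
    have hx' : 0 < x := hx
    rw [one_mul, Real.norm_eq_abs, abs_of_nonneg (by simp [hx'.le])]
    refine le_min (by linarith [Real.exp_pos (-x)]) ?_
    linarith [Real.add_one_le_exp (-x)]
  rw [bernstein, setIntegral_pos_iff_support_of_nonneg_ae _ hint]
  · have : Set.Ioi (0 : ℝ) ⊆ Function.support fun x : ℝ ↦ 1 - Real.exp (-(1 * x)) := by
      intro x hx
      have hx' : 0 < x := hx
      have : Real.exp (-(1 * x)) < 1 := by simpa using hx'
      exact (sub_pos.2 this).ne'
    rw [Set.inter_eq_right.2 this]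
    exact pos_iff_ne_zero.2 hν0
  · filter_upwards [ae_restrict_mem measurableSet_Ioi] with x hx
    have hx' : 0 < x := hx
    simp [hx'.le]

/-- A process whose Laplace exponent is positive at `1` grows at least linearly. -/
theorem eventually_linear_lt_of_hasLaplaceExponent [IsFiniteMeasure P] {T : ℝ≥0 → Ω → ℝ}
    {f : ℝ → ℝ} (hf : HasLaplaceExponent T f P) (hf1 : 0 < f 1) :
    ∀ᵐ ω ∂P, ∀ᶠ n : ℕ in atTop, f 1 / 2 * n < T n ω := by
  have hle (n : ℕ) : P.real {ω | T n ω ≤ f 1 / 2 * n} ≤ Real.exp (-(f 1 / 2)) ^ n := by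
    have h := hf n 1 zero_le_one
    have hint : Integrable (fun ω ↦ Real.exp (-1 * T n ω)) P := by
      -- A non-integrable function would have integral `0`, but the Laplace transform is positive.
      refine Integrable.of_integral_ne_zero ?_
      simp only [one_mul] at h
      simp only [neg_mul, one_mul, h]
      exact (Real.exp_pos _).ne'
    refine (measure_le_le_exp_mul_mgf (X := T n) (f 1 / 2 * n) (by norm_num : (-1 : ℝ) ≤ 0)
      hint).trans (le_of_eq ?_)
    have hm : mgf (T n) P (-1) = Real.exp (-(n * f 1)) := by
      simpa [mgf] using h
    rw [hm, ← Real.exp_add, ← Real.exp_nat_mul]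
    congr 1; ring
  have hsum : ∑' n : ℕ, P {ω | T n ω ≤ f 1 / 2 * n} ≠ ∞ := by
    have hs : Summable fun n : ℕ ↦ P.real {ω | T n ω ≤ f 1 / 2 * n} :=
      Summable.of_nonneg_of_le (fun _ ↦ measureReal_nonneg) hle
        (summable_geometric_of_lt_one (Real.exp_pos _).le (by simpa using hf1))
    have := hs.tsum_ofReal_ne_top
    simpa only [ofReal_measureReal (measure_ne_top P _)] using this
  filter_upwards [ae_eventually_notMem hsum] with ω hω
  filter_upwards [hω] with n hn
  exact not_le.1 hn

theorem inverseSubordinator_le {T : ℝ≥0 → Ω → ℝ} {t τ : ℝ≥0} {ω : Ω} (hτ : 0 < τ)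
    (h : (t : ℝ) < T τ ω) : inverseSubordinator T t ω ≤ τ :=
  csInf_le (OrderBot.bddBelow _) ⟨hτ, h⟩

theorem inverseSubordinator_le_of_linear_lt {T : ℝ≥0 → Ω → ℝ} {ω : Ω} {c : ℝ} (hc : 0 < c)
    (h : ∀ᶠ n : ℕ in atTop, c * n < T n ω) :
    ∃ K : ℝ, ∀ t : ℝ≥0, (inverseSubordinator T t ω : ℝ) ≤ t / c + K := by
  obtain ⟨N, hN⟩ := eventually_atTop.1 h
  refine ⟨N + 2, fun t ↦ ?_⟩
  -- The ceiling gives `c * n ≥ t`, `N` puts the index in the range of `hN`, and `+ 1` makes it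
  -- positive.
  have hle : inverseSubordinator T t ω ≤ ((⌈(t : ℝ) / c⌉₊ + N + 1 : ℕ) : ℝ≥0) := by
    refine inverseSubordinator_le (by positivity) (lt_of_le_of_lt ?_ (hN _ (by omega)))
    have h1 : (t : ℝ) / c ≤ ((⌈(t : ℝ) / c⌉₊ + N + 1 : ℕ) : ℝ) := by
      push_cast
      linarith [Nat.le_ceil ((t : ℝ) / c), (Nat.cast_nonneg N : (0 : ℝ) ≤ N)]
    rw [div_le_iff₀ hc] at h1
    linarith
  have hle' : (inverseSubordinator T t ω : ℝ) ≤ ((⌈(t : ℝ) / c⌉₊ + N + 1 : ℕ) : ℝ) := by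
    exact_mod_cast hle
  push_cast at hle'
  linarith [Nat.ceil_lt_add_one (show 0 ≤ (t : ℝ) / c by positivity)]

/-- A continuous function of sublinear growth is bounded by `ε s + C` for every `ε > 0`. -/
theorem exists_abs_le_of_tendsto_div {b : ℝ≥0 → ℝ} (hb : Continuous b)
    (h : Tendsto (fun s : ℝ≥0 ↦ b s / (s : ℝ)) atTop (𝓝 0)) {ε : ℝ} (hε : 0 < ε) :
    ∃ C : ℝ, ∀ s : ℝ≥0, |b s| ≤ ε * s + C := by
  obtain ⟨M, hM⟩ := Metric.tendsto_atTop.1 h ε hε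
  obtain ⟨C, hC⟩ := (isCompact_Icc (a := (0 : ℝ≥0)) (b := M + 1)).exists_bound_of_continuousOn
    hb.continuousOn
  have hC0 : 0 ≤ C := (norm_nonneg _).trans (hC 0 ⟨le_rfl, by positivity⟩)
  refine ⟨C, fun s ↦ ?_⟩
  rcases le_total s (M + 1) with hs | hs
  · have := hC s ⟨zero_le, hs⟩
    rw [Real.norm_eq_abs] at this
    have : 0 ≤ ε * (s : ℝ) := by positivity
    linarith
  · have hs0 : (0 : ℝ) < s := by
      exact_mod_cast lt_of_lt_of_le (by positivity : 0 < M + 1) hs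
    have := hM s (le_trans (by simp) hs)
    rw [dist_zero_right, Real.norm_eq_abs, abs_div, abs_of_pos hs0, div_lt_iff₀ hs0] at this
    linarith

/-- A continuous function of sublinear growth, composed with a time change of at most linear
growth, is of sublinear growth. -/
theorem tendsto_comp_div_of_linear_le {b : ℝ≥0 → ℝ} (hb : Continuous b)
    (h : Tendsto (fun s : ℝ≥0 ↦ b s / (s : ℝ)) atTop (𝓝 0)) {S : ℝ≥0 → ℝ≥0} {c K : ℝ}
    (hc : 0 < c) (hS : ∀ t : ℝ≥0, (S t : ℝ) ≤ t / c + K) :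
    Tendsto (fun t : ℝ≥0 ↦ b (S t) / (t : ℝ)) atTop (𝓝 0) := by
  rw [tendsto_order]
  suffices H : ∀ ε : ℝ, 0 < ε → ∀ᶠ t : ℝ≥0 in atTop, |b (S t) / (t : ℝ)| < ε by
    refine ⟨fun a ha ↦ ?_, fun a ha ↦ ?_⟩
    · filter_upwards [H (-a) (by linarith)] with t ht
      linarith [(abs_lt.1 ht).1]
    · filter_upwards [H a ha] with t ht using (abs_lt.1 ht).2
  intro ε hε
  -- With this slope the term `t / c` contributes `ε / 2 * t`; the other half absorbs the constants.
  obtain ⟨C, hC⟩ := exists_abs_le_of_tendsto_div hb h (ε := ε * c / 2) (by positivity)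
  have ht : Tendsto (fun t : ℝ≥0 ↦ (t : ℝ)) atTop atTop := NNReal.tendsto_coe_atTop.2 tendsto_id
  filter_upwards [ht.eventually_gt_atTop 0,
    ht.eventually_gt_atTop ((ε * c / 2 * K + C) / (ε / 2))] with t ht0 ht1
  rw [div_lt_iff₀ (by positivity)] at ht1
  rw [abs_div, abs_of_pos ht0, div_lt_iff₀ ht0]
  calc |b (S t)| ≤ ε * c / 2 * S t + C := hC _
    _ ≤ ε * c / 2 * (t / c + K) + C := by gcongr; exact hS t
    _ = ε / 2 * t + (ε * c / 2 * K + C) := by field_simp; ring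
    _ < ε * t := by linarith

end DelayedBM

/-- **Law of large numbers** for a Brownian motion delayed by an independent inverse
subordinator. -/
theorem mainTheorem5 {Ω : Type*} [MeasurableSpace Ω] (P : Measure Ω) [IsProbabilityMeasure P]
    (ν : Measure ℝ) (hν : DelayedBM.IsSubordinatorLevyMeasure ν)
    (hν_inf : ν (Set.Ioi 0) = ∞)
    (T : ℝ≥0 → Ω → ℝ) (hT : DelayedBM.IsSubordinator T P)
    (hTν : DelayedBM.HasLaplaceExponent T (DelayedBM.bernstein ν) P)
    (B : ℝ≥0 → Ω → ℝ) (hB : IsBrownianReal B P)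
    (hBS : IndepFun (fun ω (t : ℝ≥0) ↦ B t ω)
      (fun ω (t : ℝ≥0) ↦ DelayedBM.inverseSubordinator T t ω) P) :
    ∀ᵐ ω ∂P, Tendsto (fun t : ℝ≥0 ↦ DelayedBM.subdiffusion B T t ω / (t : ℝ)) atTop (𝓝 0) := by

  have hf : 0 < DelayedBM.bernstein ν 1 := DelayedBM.bernstein_one_pos hν (by simp [hν_inf])
  filter_upwards [DelayedBM.tendsto_brownian_div_atTop hB, hB.cont,
    DelayedBM.eventually_linear_lt_of_hasLaplaceExponent hTν hf] with ω hω hc hTω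
  obtain ⟨K, hK⟩ := DelayedBM.inverseSubordinator_le_of_linear_lt (half_pos hf) hTω
  exact DelayedBM.tendsto_comp_div_of_linear_le hc hω (half_pos hf) hK
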